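/- Let $K$ be a field and let $n,k\ge 0$ be integers. The permutohedral ideal is the monomial ideal $$I_{n,k}=\prod_{1\le i_1<\dots<i_k\le n}(x_{i_1},\dots,x_{i_k})\subseteq K[x_1,\dots,x_n].$$ (For $k>n$ the product is empty and $I_{n,k}=(1)$; for $k=0$ it is the zero ideal.) An ideal $I$ of $K[x_1,\dots,x_n]$ is called tame if the blowup $\operatorname{Proj}\bigl(\bigoplus_{d\ge 0}I^d\bigr)$ of $\mathbb A^n_K$ in $I$ is smooth over $K$. For a monomial ideal $I$, the cloud of $I$ is the set $A\subset\mathbb N^n$ of exponent vectors of its minimal monomial generators, the Newton polyhedron $N(I)\subseteq\mathbb R^n$ is the convex hull of the exponent vectors of all monomials in $I$, and the ideal tangent cone of $I$ at $a\in\mathbb N^n$ is $$IT_a(I)=\mathbb N\langle a'-a : a'\in A,\ a'\ne a\rangle+\mathbb N\langle e_1,\dots,e_n\rangle\subseteq\mathbb Z^n.$$ It is called simplicial if $IT_a(I)\cap(-IT_a(I))=\{0\}$ and it has a minimal generating set (no element is an $\mathbb N$-linear combination of the others) with exactly $n$ elements. Proposition. For all $n$ and $k$ the ideal $I_{n,k}$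 is tame. Moreover, if $k\ge1$, the vertices of $N(I_{n,k})$ are exactly the points obtained by permuting the coordinates of $$\Bigl(\tbinom{n-1}{k-1},\tbinom{n-2}{k-1},\dots,\tbinom{0}{k-1}\Bigr)$$ (which, for $1\le k\le n$, is $\bigl(\tbinom{n-1}{k-1},\dots,\tbinom{k}{k-1},1,0,\dots,0\bigr)$ with $k-1$ zeros), and at every vertex $a$ of $N(I_{n,k})$ the ideal tangent cone $IT_a(I_{n,k})$ is simplicial. -/

import Mathlib

open CategoryTheory AlgebraicGeometry

universe u

noncomputable section

section Rees

variable {R : Type u} [CommRing R] (I : Ideal R)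

/-- The degree `d` part `I ^ d · t ^ d` of the Rees algebra `R[I t] ⊆ R[t]` of `I`. -/
def reesGrading (d : ℕ) : Submodule R (reesAlgebra I) :=
  (LinearMap.range (Polynomial.monomial d : R →ₗ[R] Polynomial R)).comap
    (reesAlgebra I).val.toLinearMap

theorem mem_reesGrading_iff {d : ℕ} {f : reesAlgebra I} :
    f ∈ reesGrading I d ↔ ∀ j, j ≠ d → (f : Polynomial R).coeff j = 0 := by
  constructor
  · rintro ⟨r, hr⟩ j hj
    have h : (f : Polynomial R) = Polynomial.monomial d r := hr.symm
    rw [h, Polynomial.coeff_monomial, if_neg hj.symm]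
  · intro h
    refine ⟨(f : Polynomial R).coeff d, ?_⟩
    change _ = (f : Polynomial R)
    ext j
    rw [Polynomial.coeff_monomial]
    split_ifs with hj
    · rw [hj]
    · rw [h j (Ne.symm hj)]

/-- The homogeneous component of degree `d` of an element of the Rees algebra. -/
def reesComponent (d : ℕ) (f : reesAlgebra I) : reesGrading I d :=
  ⟨⟨Polynomial.monomial d ((f : Polynomial R).coeff d),
    reesAlgebra.monomial_mem.mpr (f.2 d)⟩, ⟨_, rfl⟩⟩

theorem reesComponent_eq_zero {d : ℕ} {f : reesAlgebra I}
    (h : d ∉ (f : Polynomial R).support) : reesComponent I d f = 0 := by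
  apply Subtype.ext
  apply Subtype.ext
  simp [reesComponent, Polynomial.notMem_support_iff.mp h]

instance reesGrading.gradedMonoid : SetLike.GradedMonoid (reesGrading I) where
  one_mem := ⟨1, rfl⟩
  mul_mem := by
    rintro i j f g ⟨r, hr⟩ ⟨s, hs⟩
    refine ⟨r * s, ?_⟩
    have hf : (f : Polynomial R) = Polynomial.monomial i r := hr.symm
    have hg : (g : Polynomial R) = Polynomial.monomial j s := hs.symm
    change _ = (f : Polynomial R) * (g : Polynomial R)
    rw [hf, hg, Polynomial.monomial_mul_monomial]

/-- The family of homogeneous components of an element of the Rees algebra. -/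
def reesComponents (f : reesAlgebra I) : DirectSum ℕ (fun d => reesGrading I d) :=
  DirectSum.mk (fun d => reesGrading I d) (f : Polynomial R).support
    (fun d => reesComponent I d f)

theorem reesComponents_apply (f : reesAlgebra I) (d : ℕ) :
    reesComponents I f d = reesComponent I d f := by
  by_cases h : d ∈ (f : Polynomial R).support
  · exact DirectSum.mk_apply_of_mem h
  · rw [reesComponent_eq_zero I h]
    exact DirectSum.mk_apply_of_notMem h

theorem coeff_coeAddMonoidHom (x : DirectSum ℕ (fun d => reesGrading I d)) (d : ℕ) :
    ((DirectSum.coeAddMonoidHom (reesGrading I) x : reesAlgebra I) : Polynomial R).coeff d =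
      (((x d : reesGrading I d) : reesAlgebra I) : Polynomial R).coeff d := by
  induction x using DirectSum.induction_on with
  | zero => simp
  | of i y =>
    rw [DirectSum.coeAddMonoidHom_of]
    by_cases h : i = d
    · subst h
      rw [DirectSum.of_eq_same]
    · rw [DirectSum.of_eq_of_ne _ _ _ (Ne.symm h), (mem_reesGrading_iff I).mp y.2 d (Ne.symm h)]
      rfl
  | add x y hx hy =>
    simp only [map_add, Subalgebra.coe_add, Polynomial.coeff_add, hx, hy, DirectSum.add_apply,
      Submodule.coe_add]

instance reesGrading.decomposition : DirectSum.Decomposition (reesGrading I) where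
  decompose' := reesComponents I
  left_inv f := by
    apply Subtype.ext
    ext d
    rw [coeff_coeAddMonoidHom, reesComponents_apply]
    exact Polynomial.coeff_monomial_same d _
  right_inv x := by
    refine DFinsupp.ext fun d => ?_
    apply Subtype.ext
    apply Subtype.ext
    ext j
    change (((reesComponents I _ d : reesGrading I d) : reesAlgebra I) : Polynomial R).coeff j = _
    rw [reesComponents_apply]
    change (Polynomial.monomial d _ : Polynomial R).coeff j = _
    rw [Polynomial.coeff_monomial, coeff_coeAddMonoidHom]
    split_ifs with h
    · rw [h]
    · rw [(mem_reesGrading_iff I).mp (x d).2 j (Ne.symm h)]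

instance reesGrading.gradedAlgebra : GradedAlgebra (reesGrading I) where

/-- The blowup of `Spec R` in the centre defined by `I`: the scheme `Proj (⨁ I ^ d)`. -/
def blowup : Scheme.{u} := Proj (reesGrading I)

/-- The blowup map. -/
def blowupMap : blowup I ⟶ Spec (CommRingCat.of R) :=
  Proj.toSpecZero (reesGrading I) ≫
    Spec.map (CommRingCat.ofHom (algebraMap R (reesGrading I 0)))

end Rees

section Monomial

variable {K : Type u} [Field K] {n : ℕ}

/-- An ideal of `K[x_1, …, x_n]` is tame if the blowup of affine space in it is smooth over `K`. -/
def IsTame (I : Ideal (MvPolynomial (Fin n) K)) : Prop :=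
  Smooth (blowupMap I ≫
    Spec.map (CommRingCat.ofHom (algebraMap K (MvPolynomial (Fin n) K))))

/-- The exponent vectors of the monomials that lie in `I`. -/
def idealSupport (I : Ideal (MvPolynomial (Fin n) K)) : Set (Fin n →₀ ℕ) :=
  {a | MvPolynomial.monomial a 1 ∈ I}

/-- The cloud of a monomial ideal: the exponent vectors of its minimal monomial generators. -/
def cloud (I : Ideal (MvPolynomial (Fin n) K)) : Set (Fin n →₀ ℕ) :=
  {a | Minimal (· ∈ idealSupport I) a}

/-- The exponent vector `a` as a point of `ℝ ^ n`. -/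
def toRealPoint (a : Fin n →₀ ℕ) : Fin n → ℝ := fun i => (a i : ℝ)

/-- The exponent vector `a` as a point of `ℤ ^ n`. -/
def toLatticePoint (a : Fin n →₀ ℕ) : Fin n → ℤ := fun i => (a i : ℤ)

/-- The Newton polyhedron `conv (supp I) ⊆ ℝ ^ n`. -/
def newtonPolyhedron (I : Ideal (MvPolynomial (Fin n) K)) : Set (Fin n → ℝ) :=
  convexHull ℝ (toRealPoint '' idealSupport I)

/-- The vertices of the Newton polyhedron. -/
def newtonVertices (I : Ideal (MvPolynomial (Fin n) K)) : Set (Fin n → ℝ) :=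
  Set.extremePoints ℝ (newtonPolyhedron I)

/-- The ideal tangent cone of a monomial ideal at `a`: the `ℕ`-span of the differences `a' - a`,
where `a' ≠ a` runs over the cloud, and of the standard basis vectors. -/
def idealTangentCone (I : Ideal (MvPolynomial (Fin n) K)) (a : Fin n →₀ ℕ) :
    AddSubmonoid (Fin n → ℤ) :=
  AddSubmonoid.closure {v | ∃ a' ∈ cloud I, a' ≠ a ∧ v = toLatticePoint a' - toLatticePoint a} ⊔
    AddSubmonoid.closure (Set.range fun i : Fin n => (Pi.single i 1 : Fin n → ℤ))

/-- An `ℕ`-span is pointed if it contains no nonzero vector together with its negative. -/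
def IsPointed (C : AddSubmonoid (Fin n → ℤ)) : Prop :=
  ∀ v, v ∈ C → -v ∈ C → v = 0

/-- `S` is a minimal (finite) set of generators of `C`: it generates `C`, and no element of `S` is
an `ℕ`-linear combination of the other elements. -/
def IsMinimalGeneratingSet (C : AddSubmonoid (Fin n → ℤ)) (S : Finset (Fin n → ℤ)) : Prop :=
  AddSubmonoid.closure (S : Set (Fin n → ℤ)) = C ∧
    ∀ v ∈ S, v ∉ AddSubmonoid.closure ((S : Set (Fin n → ℤ)) \ {v})

/-- A cone is simplicial if it is pointed and its minimal set of generators (which is unique for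
a pointed cone) has exactly `n` elements. -/
def IsSimplicialCone (C : AddSubmonoid (Fin n → ℤ)) : Prop :=
  IsPointed C ∧ ∃ S : Finset (Fin n → ℤ), IsMinimalGeneratingSet C S ∧ S.card = n

end Monomial

/-- The permutohedral ideal `I_{n,k}`, the product of the ideals `(x_{i_1}, …, x_{i_k})` over all
subsets `{i_1 < … < i_k}` of the index set. -/
def permutohedralIdeal (K : Type u) [Field K] (n k : ℕ) : Ideal (MvPolynomial (Fin n) K) :=
  ∏ s ∈ Finset.powersetCard k (Finset.univ : Finset (Fin n)),
    Ideal.span ((fun i => (MvPolynomial.X i : MvPolynomial (Fin n) K)) '' (s : Set (Fin n)))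

/-- The vector `(C(n-1,k-1), C(n-2,k-1), …, C(k,k-1), 1, 0, …, 0)`; the coordinates are numbered
from `0`. It is meant for `1 ≤ k`. -/
def maxVector (n k : ℕ) : Fin n → ℝ := fun i => ((n - 1 - (i : ℕ)).choose (k - 1) : ℝ)

end

/-! Expanding the product, the ideal is generated by the monomials `x^{v(c)} = ∏ x_{c(S)}`, one for
each choice `c` of an element in every `k`-subset `S`. A linear order `σ` on the variables singles
out the choice of the `σ`-minima. These choices give the vertices: such a choice is the only minimum
on the support of a linear form with positive coefficients increasing along `σ`. Conversely, for
every choice `c`, refine by a linear order `σ` the relation "`e_j - e_i` is an `ℕ`-combination of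
vectors `v(c') - v(c)`". Then some multiple `(p + 1) v(c)` is `v(f)` plus `p` vectors of choices,
where `f` is the minimal choice for `σ` (`exists_isMinChoice_add_eq`). So there are no other
vertices, and the charts at the vertices cover the blowup.

At the vertex of `σ` everything is governed by a forest. For `2 ≤ k ≤ n` it is a tree: the positions
`0, …, n - k` form a path, and the last `k - 1` positions all hang from position `n - k`. The
minimum of a `k`-subset has position at most `n - k`, hence is an ancestor of all its members
(`treeBranch_le`); and each parent is the minimum of a `k`-subset containing its child
(`exists_kSubset_parent`). Hence the vectors `e_i - e_{parent i}`, with `e_i` for a root, form a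
basis of `ℤ^n` that generates the tangent cone, and the chart is a polynomial ring in the quotients
`x_i / x_{parent i}` and the roots `x_i`. For `k ≤ 1` or `n < k` all indices are roots, and the same
argument applies. -/

noncomputable section

/-! ### Charts of a blowup as affine blowup algebras -/

section BlowupChart

variable {R : Type u} [CommRing R] (I : Ideal R)

/-- The element `r · t ^ d` of the Rees algebra. -/
def reesMonomial (d : ℕ) (r : R) (hr : r ∈ I ^ d) : reesAlgebra I :=
  ⟨Polynomial.monomial d r, reesAlgebra.monomial_mem.mpr hr⟩

theorem coe_reesMonomial (d : ℕ) (r : R) (hr : r ∈ I ^ d) :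
    (reesMonomial I d r hr : Polynomial R) = Polynomial.monomial d r := rfl

theorem reesMonomial_mem (d : ℕ) (r : R) (hr : r ∈ I ^ d) :
    reesMonomial I d r hr ∈ reesGrading I d := ⟨r, rfl⟩

theorem exists_eq_reesMonomial {d : ℕ} {f : reesAlgebra I} (hf : f ∈ reesGrading I d) :
    ∃ r, ∃ hr : r ∈ I ^ d, f = reesMonomial I d r hr := by
  obtain ⟨r, hr⟩ := hf
  have hr' : (f : Polynomial R) = Polynomial.monomial d r := hr.symm
  refine ⟨r, ?_, Subtype.ext hr'⟩
  rw [← reesAlgebra.monomial_mem, ← hr']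
  exact f.2

theorem reesMonomial_mul {d e : ℕ} {r r' : R} (hr : r ∈ I ^ d) (hr' : r' ∈ I ^ e)
    (h : r * r' ∈ I ^ (d + e)) :
    reesMonomial I d r hr * reesMonomial I e r' hr' = reesMonomial I (d + e) (r * r') h :=
  Subtype.ext (Polynomial.monomial_mul_monomial ..)

theorem reesMonomial_pow {d : ℕ} {r : R} (hr : r ∈ I ^ d) (m : ℕ) (h : r ^ m ∈ I ^ (d * m)) :
    reesMonomial I d r hr ^ m = reesMonomial I (d * m) (r ^ m) h :=
  Subtype.ext (Polynomial.monomial_pow ..)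

theorem reesMonomial_congr {d e : ℕ} {r r' : R} (hr : r ∈ I ^ d) (hr' : r' ∈ I ^ e) (h : d = e)
    (h' : r = r') : reesMonomial I d r hr = reesMonomial I e r' hr' := by
  subst h h'
  rfl

theorem reesMonomial_zero (d : ℕ) : reesMonomial I d 0 (zero_mem _) = 0 := by
  apply Subtype.ext
  rw [coe_reesMonomial, map_zero, Subalgebra.coe_zero]

theorem reesMonomial_add {d : ℕ} {r r' : R} (hr : r ∈ I ^ d) (hr' : r' ∈ I ^ d) :
    reesMonomial I d (r + r') (add_mem hr hr') =
      reesMonomial I d r hr + reesMonomial I d r' hr' := by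
  apply Subtype.ext
  simp only [Subalgebra.coe_add, coe_reesMonomial, map_add]

theorem reesMonomial_const_mul {d : ℕ} (a : R) {r : R} (hr : r ∈ I ^ d) :
    reesMonomial I d (a * r) (Ideal.mul_mem_left _ a hr) =
      algebraMap R _ a * reesMonomial I d r hr := by
  apply Subtype.ext
  rw [Subalgebra.coe_mul, coe_reesMonomial, coe_reesMonomial, Subalgebra.coe_algebraMap,
    Polynomial.algebraMap_eq, Polynomial.C_mul_monomial]

/-- The degree `1` element `s · t` of the Rees algebra. -/
def reesT (s : R) (hs : s ∈ I) : reesAlgebra I := reesMonomial I 1 s ((pow_one I).symm ▸ hs)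

theorem reesT_mem (s : R) (hs : s ∈ I) : reesT I s hs ∈ reesGrading I 1 :=
  reesMonomial_mem I 1 s _

/-- The coordinate ring of the chart of the blowup on which `s` generates the ideal. -/
def BlowupChart (s : R) (hs : s ∈ I) : Type u :=
  HomogeneousLocalization.Away (reesGrading I) (reesT I s hs)

instance (s : R) (hs : s ∈ I) : CommRing (BlowupChart I s hs) :=
  inferInstanceAs (CommRing (HomogeneousLocalization.Away (reesGrading I) (reesT I s hs)))

/-- The structure map of a chart of the blowup. -/
def toBlowupChart (s : R) (hs : s ∈ I) : R →+* BlowupChart I s hs :=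
  (HomogeneousLocalization.fromZeroRingHom (reesGrading I) _).comp
    (algebraMap R (reesGrading I 0))

/-- The inclusion of a chart of the blowup in a localization of the Rees algebra. -/
def blowupChartVal (s : R) (hs : s ∈ I) :
    BlowupChart I s hs →+* Localization (Submonoid.powers (reesT I s hs)) where
  toFun := HomogeneousLocalization.val
  map_one' := HomogeneousLocalization.val_one
  map_mul' := HomogeneousLocalization.val_mul
  map_zero' := HomogeneousLocalization.val_zero
  map_add' := HomogeneousLocalization.val_add

theorem blowupChartVal_injective (s : R) (hs : s ∈ I) :
    Function.Injective (blowupChartVal I s hs) :=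
  HomogeneousLocalization.val_injective _

theorem blowupChartVal_toBlowupChart (s : R) (hs : s ∈ I) (r : R) :
    blowupChartVal I s hs (toBlowupChart I s hs r) =
      algebraMap (reesAlgebra I) (Localization (Submonoid.powers (reesT I s hs)))
        (algebraMap R (reesAlgebra I) r) := by
  rw [← Localization.mk_one_eq_algebraMap]
  rfl

variable {I} {s : R} (hs : s ∈ I)

/-- The element `r t ^ d / (s t) ^ d` of a chart of the blowup. -/
def blowupChartMk (d : ℕ) (f : reesAlgebra I) (hf : f ∈ reesGrading I d) :
    BlowupChart I s hs :=
  HomogeneousLocalization.Away.mk (reesGrading I) (reesT_mem I s hs) d f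
    (by rwa [smul_eq_mul, mul_one])

theorem blowupChartVal_mk (d : ℕ) (f : reesAlgebra I) (hf : f ∈ reesGrading I d) :
    blowupChartVal I s hs (blowupChartMk hs d f hf) =
      IsLocalization.mk' _ f
        (⟨reesT I s hs ^ d, d, rfl⟩ : Submonoid.powers (reesT I s hs)) := by
  rw [← Localization.mk_eq_mk']
  rfl

/-- In the Rees algebra, `s^d · (r t^d) = r · (s t)^d`. -/
theorem blowupChart_mk_mul {d : ℕ} {r : R} (hr : r ∈ I ^ d)
    (h : reesMonomial I d r hr ∈ reesGrading I d) :
    blowupChartMk hs d (reesMonomial I d r hr) h * toBlowupChart I s hs s ^ d =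
      toBlowupChart I s hs r := by
  apply blowupChartVal_injective
  rw [map_mul, map_pow, blowupChartVal_toBlowupChart, blowupChartVal_toBlowupChart,
    blowupChartVal_mk, ← map_pow,
    mul_comm, IsLocalization.mul_mk'_eq_mk'_of_mul, IsLocalization.mk'_eq_iff_eq_mul, ← map_mul]
  congr 1
  apply Subtype.ext
  change (Polynomial.C s) ^ d * Polynomial.monomial d r =
    Polynomial.C r * (Polynomial.monomial 1 s) ^ d
  rw [Polynomial.monomial_pow, ← Polynomial.C_pow, Polynomial.C_mul_monomial,
    Polynomial.C_mul_monomial, one_mul, mul_comm]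

theorem blowupChart_exists_mul_eq {r : R} (hr : r ∈ I) :
    ∃ b, b * toBlowupChart I s hs s = toBlowupChart I s hs r := by
  have hr' : r ∈ I ^ 1 := by rwa [pow_one]
  have h := blowupChart_mk_mul hs hr' (reesMonomial_mem I 1 r hr')
  generalize blowupChartMk hs 1 _ _ = b at h
  exact ⟨b, by rwa [pow_one] at h⟩

/-- With `blowupChart_exists_mul_eq` this says that the chart is `R[I/s]`; later arguments use only
these two properties and the injectivity of the structure map. -/
theorem blowupChart_exists_rep (b : BlowupChart I s hs) :
    ∃ d, ∃ r ∈ I ^ d, b * toBlowupChart I s hs s ^ d = toBlowupChart I s hs r := by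
  obtain ⟨d, a, ha, rfl⟩ := HomogeneousLocalization.Away.mk_surjective (reesGrading I)
    (reesT_mem I s hs) b
  obtain ⟨r, hr, rfl⟩ := exists_eq_reesMonomial I ha
  have e : d • 1 = d := by rw [smul_eq_mul, mul_one]
  have hr' : r ∈ I ^ d := by rwa [e] at hr
  refine ⟨d, r, hr', ?_⟩
  rw [← blowupChart_mk_mul hs hr' (reesMonomial_mem I d r hr')]
  congr 2
  exact reesMonomial_congr I hr hr' e rfl

theorem powers_reesT_le_nonZeroDivisors [IsDomain R] (hs0 : s ≠ 0) :
    Submonoid.powers (reesT I s hs) ≤ nonZeroDivisors (reesAlgebra I) := by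
  rw [Submonoid.powers_le, mem_nonZeroDivisors_iff_ne_zero]
  intro h
  have h' : Polynomial.monomial 1 s = (0 : Polynomial R) := congrArg Subtype.val h
  exact hs0 ((Polynomial.monomial_eq_zero_iff _ _).mp h')

theorem blowupChart_isDomain [IsDomain R] (hs0 : s ≠ 0) : IsDomain (BlowupChart I s hs) := by
  have := IsLocalization.isDomain_localization (powers_reesT_le_nonZeroDivisors hs hs0)
  exact (blowupChartVal_injective I s hs).isDomain _

theorem toBlowupChart_injective [IsDomain R] (hs0 : s ≠ 0) :
    Function.Injective (toBlowupChart I s hs) := by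
  intro r r' h
  have h' := congrArg (blowupChartVal I s hs) h
  rw [blowupChartVal_toBlowupChart, blowupChartVal_toBlowupChart] at h'
  have h'' := IsLocalization.injective _ (powers_reesT_le_nonZeroDivisors hs hs0) h'
  exact Polynomial.C_injective (congrArg Subtype.val h'')

/-- Let `B` be the ring `R[I/s]`. A map `φ` to `B` is bijective if the structure map of `B` is
`φ ∘ ψ`, where `ψ` is birational and makes the ideal principal with generator `ψ s`. -/
theorem bijective_of_affineBlowup {R B P : Type*} [CommRing R] [CommRing B] [IsDomain B]
    [CommRing P] [IsDomain P] {I : Ideal R} {s : R} (hs0 : s ≠ 0) (j : R →+* B)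
    (hj : Function.Injective j) (hB : ∀ b, ∃ d, ∃ r ∈ I ^ d, b * j s ^ d = j r)
    (ψ : R →+* P) (φ : P →+* B) (hφψ : ∀ r, φ (ψ r) = j r)
    (hI : I.map ψ ≤ Ideal.span {ψ s}) (hb : ∀ q, ∃ r r', ψ r ≠ 0 ∧ q * ψ r = ψ r') :
    Function.Bijective φ := by
  constructor
  · rw [injective_iff_map_eq_zero]
    intro q hq
    obtain ⟨r, r', hr, hrr'⟩ := hb q
    have h1 : j r' = 0 := by rw [← hφψ, ← hrr', map_mul, hq, zero_mul]
    have h2 : r' = 0 := hj (by rw [h1, map_zero])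
    rw [h2, map_zero] at hrr'
    exact (mul_eq_zero.mp hrr').resolve_right hr
  · intro b
    obtain ⟨d, r, hr, hbr⟩ := hB b
    -- The extension of `I ^ d` lies in the ideal of `ψ s ^ d`, so the fraction `r / s ^ d` already
    -- comes from an element of `P`.
    have h1 : ψ r ∈ Ideal.span {ψ s ^ d} := by
      rw [← Ideal.span_singleton_pow]
      refine Ideal.pow_right_mono hI d ?_
      rw [← Ideal.map_pow]
      exact Ideal.mem_map_of_mem ψ hr
    obtain ⟨q, hq⟩ := Ideal.mem_span_singleton'.mp h1
    refine ⟨q, ?_⟩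
    have h3 : j s ≠ 0 := fun h => hs0 (hj (by rw [h, map_zero]))
    apply mul_right_cancel₀ (pow_ne_zero d h3)
    rw [hbr, ← hφψ r, ← hq, map_mul, map_pow, hφψ]

end BlowupChart

/-! ### Smoothness is local on the blowup -/

section Smooth

variable {K R : Type u} [CommRing K] [CommRing R]

/-- The blowup is smooth if the irrelevant ideal is covered by charts that are smooth. -/
theorem smooth_blowup_of_charts {I : Ideal R} (g : K →+* R) {ι : Type*} (s : ι → R)
    (hs : ∀ i, s i ∈ I)
    (hcover : ∀ x : Proj (reesGrading I), ∃ i, reesT I (s i) (hs i) ∉ x.asHomogeneousIdeal)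
    (hsm : ∀ i, ((toBlowupChart I (s i) (hs i)).comp g).Smooth) :
    Smooth (blowupMap I ≫ Spec.map (CommRingCat.ofHom g)) := by
  have hdeg (i : ι) : reesT I (s i) (hs i) ∈ reesGrading I 1 := reesT_mem I _ _
  let U : (Proj (reesGrading I)).OpenCover :=
    -- The cover is indexed by the points, each with a chart that contains it.
    { I₀ := Proj (reesGrading I)
      X := fun x => Spec (.of (BlowupChart I (s (hcover x).choose) (hs _)))
      f := fun x => Proj.awayι (reesGrading I) _ (hdeg (hcover x).choose) one_pos
      mem₀ := by
        rw [Scheme.presieve₀_mem_precoverage_iff]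
        refine ⟨fun x => ⟨x, ?_⟩, fun x =>
          inferInstanceAs (IsOpenImmersion (Proj.awayι (reesGrading I) _ (hdeg _) one_pos))⟩
        change x ∈ (Proj.awayι _ _ _ _).opensRange
        rw [Proj.opensRange_awayι]
        exact (hcover x).choose_spec }
  have : IsZariskiLocalAtSource @Smooth.{u} :=
    HasRingHomProperty.instIsZariskiLocalAtSource (P := @Smooth.{u}) (Q := RingHom.Smooth)
  refine (IsZariskiLocalAtSource.iff_of_openCover (P := @Smooth.{u}) U).mpr fun x => ?_
  have e : U.f x ≫ blowupMap I ≫ Spec.map (CommRingCat.ofHom g) =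
      Spec.map (CommRingCat.ofHom ((toBlowupChart I (s (hcover x).choose) (hs _)).comp g)) := by
    change Proj.awayι (reesGrading I) _ (hdeg (hcover x).choose) one_pos ≫
      (Proj.toSpecZero (reesGrading I) ≫ _) ≫ _ = _
    rw [Category.assoc, Proj.awayι_toSpecZero_assoc, ← Spec.map_comp, ← Spec.map_comp]
    rfl
  exact (congrArg (fun f => Smooth f) e).mpr
    ((HasRingHomProperty.Spec_iff (P := @Smooth.{u})).mpr (hsm _))

end Smooth

/-! ### Choices, and the vertices that dominate them -/

section Choices

variable {n k : ℕ}

/-- The `k`-element subsets of `Fin n`. -/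
abbrev KSubset (n k : ℕ) : Type := {S : Finset (Fin n) // S.card = k}

/-- A choice of an element in every `k`-element subset of `Fin n`. -/
abbrev Choice (n k : ℕ) : Type := ∀ S : KSubset n k, {i : Fin n // i ∈ S.1}

/-- The exponent vector of the monomial `∏ x_{c(S)}`. -/
def choiceVector (c : Choice n k) : Fin n →₀ ℕ :=
  ∑ S : KSubset n k, Finsupp.single (c S : Fin n) 1

/-- The choice `c` picks in every subset the element that comes first in the order `σ`. -/
def IsMinChoice (σ : Equiv.Perm (Fin n)) (c : Choice n k) : Prop :=
  ∀ S, ∀ j ∈ S.1, σ (c S) ≤ σ j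

theorem exists_isMinChoice (h : ∀ S : KSubset n k, S.1.Nonempty) (σ : Equiv.Perm (Fin n)) :
    ∃ c : Choice n k, IsMinChoice σ c := by
  choose f hf hmin using fun S : KSubset n k => S.1.exists_min_image σ (h S)
  exact ⟨fun S => ⟨f S, hf S⟩, hmin⟩

theorem choiceVector_update (c : Choice n k) (S : KSubset n k) (j : {i : Fin n // i ∈ S.1}) :
    choiceVector (Function.update c S j) + Finsupp.single (c S : Fin n) 1 =
      choiceVector c + Finsupp.single (j : Fin n) 1 := by
  have h : ∑ T ∈ Finset.univ.erase S, Finsupp.single (Function.update c S j T : Fin n) 1 =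
      ∑ T ∈ Finset.univ.erase S, (Finsupp.single (c T : Fin n) 1 : Fin n →₀ ℕ) :=
    Finset.sum_congr rfl fun T hT => by rw [Function.update_of_ne (Finset.ne_of_mem_erase hT)]
  rw [choiceVector, choiceVector, ← Finset.sum_erase_add _ _ (Finset.mem_univ S), h,
    ← Finset.sum_erase_add _ _ (Finset.mem_univ S), Function.update_self]
  abel

theorem degree_choiceVector (c : Choice n k) :
    (choiceVector c).degree = Fintype.card (KSubset n k) := by
  simp [choiceVector]

/-- The sum of the exponent vectors of the members of a multiset of choices. -/
def choiceSum : Multiset (Choice n k) →+ (Fin n →₀ ℕ) :=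
  Multiset.sumAddMonoidHom.comp (Multiset.mapAddMonoidHom choiceVector)

theorem choiceSum_singleton (c : Choice n k) : choiceSum {c} = choiceVector c := by
  simp [choiceSum]

/-- The quotient `x_j / x_i` is a product of monomials of the form `x ^ (c' - c)`. -/
def Dominates (c : Choice n k) (i j : Fin n) : Prop :=
  ∃ m : Multiset (Choice n k),
    choiceSum m + Finsupp.single i 1 = Finsupp.single j 1 + Multiset.card m • choiceVector c

theorem Dominates.trans {c : Choice n k} {i j l : Fin n} (h : Dominates c i j)
    (h' : Dominates c j l) : Dominates c i l := by
  obtain ⟨m, hm⟩ := h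
  obtain ⟨m', hm'⟩ := h'
  refine ⟨m + m', ?_⟩
  rw [map_add, Multiset.card_add, add_smul]
  apply add_right_cancel (b := Finsupp.single j 1)
  calc choiceSum m + choiceSum m' + Finsupp.single i 1 + Finsupp.single j 1
      = (choiceSum m + Finsupp.single i 1) + (choiceSum m' + Finsupp.single j 1) := by abel
    _ = _ := by rw [hm, hm']; abel

theorem dominates_of_mem (c : Choice n k) (S : KSubset n k) {j : Fin n} (hj : j ∈ S.1) :
    Dominates c (c S) j := by
  refine ⟨{Function.update c S ⟨j, hj⟩}, ?_⟩
  rw [choiceSum_singleton, choiceVector_update, Multiset.card_singleton, one_smul, add_comm]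

/-- A transitive relation on `Fin n` is refined by a linear order. -/
theorem exists_perm_refining (r : Fin n → Fin n → Prop)
    (htrans : ∀ i j l, r i j → r j l → r i l) :
    ∃ σ : Equiv.Perm (Fin n), ∀ i j, r i j → ¬ r j i → σ i < σ j := by
  classical
  -- The number of strict predecessors grows strictly along the strict part of `r`, so sorting by it
  -- gives the order.
  let d : Fin n → ℕ := fun i => (Finset.univ.filter fun l => r l i ∧ ¬ r i l).card
  refine ⟨(Tuple.sort d)⁻¹, fun i j hij hji => ?_⟩
  have hd : d i < d j := by
    apply Finset.card_lt_card
    rw [Finset.ssubset_iff_of_subset]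
    · exact ⟨i, by simp [hij, hji], by simp⟩
    · intro l
      simp only [Finset.mem_filter, Finset.mem_univ, true_and]
      exact fun h => ⟨htrans l i j h.1 hij, fun h' => h.2 (htrans i j l hij h')⟩
  by_contra! hle
  have h := Tuple.monotone_sort d hle
  change d (Tuple.sort d ((Tuple.sort d).symm j)) ≤ d (Tuple.sort d ((Tuple.sort d).symm i)) at h
  rw [Equiv.apply_symm_apply, Equiv.apply_symm_apply] at h
  omega

/-- Every exponent vector of a choice has a multiple that is the sum of a vertex and of exponent
vectors of choices. -/
theorem exists_isMinChoice_add_eq (c : Choice n k) :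
    ∃ (σ : Equiv.Perm (Fin n)) (f : Choice n k) (m : Multiset (Choice n k)), IsMinChoice σ f ∧
      choiceSum m + choiceVector f = (Multiset.card m + 1) • choiceVector c := by
  obtain ⟨σ, hσ⟩ := exists_perm_refining (Dominates c) fun _ _ _ => Dominates.trans
  obtain ⟨f, hf⟩ := exists_isMinChoice (fun S => ⟨_, (c S).2⟩) σ
  -- Since `c S` dominates `f S`, failure of the converse would put `c S` strictly before the
  -- minimum `f S`.
  have h (S : KSubset n k) : Dominates c (f S) (c S) := by
    by_contra hn
    exact absurd (hσ _ _ (dominates_of_mem c S (f S).2) hn) (hf S _ (c S).2).not_gt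
  choose m hm using h
  refine ⟨σ, f, ∑ S, m S, hf, ?_⟩
  -- Sum over `S`: the differences `e_{c(S)} - e_{f(S)}` add up to `v(c) - v(f)`.
  rw [map_sum, Multiset.card_sum, add_smul, one_smul, Finset.sum_smul, choiceVector,
    ← Finset.sum_add_distrib, Finset.sum_congr rfl fun S _ => hm S, Finset.sum_add_distrib, add_comm]
  rfl

end Choices

/-! ### The tree attached to a linear order -/

section Branch

variable {n : ℕ}

/-- The sum of the basis vectors of the members of the chain `i, p i, p (p i), …`. -/
def branch (p r : Fin n → Fin n) (h : ∀ i, p i ≠ i → r (p i) < r i) (i : Fin n) : Fin n →₀ ℕ :=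
  Finsupp.single i 1 + if hp : p i = i then 0 else branch p r h (p i)
termination_by r i
decreasing_by exact h _ hp

variable (k : ℕ) (σ : Equiv.Perm (Fin n))

/-- The parent of an index: its predecessor in the order `σ`, but the last `k` indices have
the same parent. It is the index itself for a root; all indices are roots if `k ≤ 1` or `n < k`. -/
def parent (i : Fin n) : Fin n :=
  if 2 ≤ k ∧ k ≤ n then
    σ.symm ⟨min (σ i - 1) (n - k), lt_of_le_of_lt ((min_le_left _ _).trans (Nat.sub_le _ _)) (σ i).2⟩
  else i

variable {k σ}

/-- By truncated subtraction position `0` is its own parent; the positions beyond `n - k` share the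
parent in position `n - k`. -/
theorem coe_parent (hk : 2 ≤ k) (hkn : k ≤ n) (i : Fin n) :
    (σ (parent k σ i) : ℕ) = min ((σ i : ℕ) - 1) (n - k) := by
  rw [parent, if_pos ⟨hk, hkn⟩, Equiv.apply_symm_apply]

theorem two_le_of_parent_ne {i : Fin n} (h : parent k σ i ≠ i) : 2 ≤ k ∧ k ≤ n := by
  by_contra h'
  exact h (if_neg h')

theorem parent_lt {i : Fin n} (h : parent k σ i ≠ i) : σ (parent k σ i) < σ i := by
  obtain ⟨hk, hkn⟩ := two_le_of_parent_ne h
  have h1 := coe_parent (σ := σ) hk hkn i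
  have h2 : (σ (parent k σ i) : ℕ) ≠ σ i := fun e => h (σ.injective (Fin.ext e))
  rw [Fin.lt_def]
  omega

theorem card_filter_le (r : Fin n) :
    (Finset.univ.filter fun j => r ≤ σ j).card = n - r := by
  rw [← Fin.card_Ici, ← Finset.card_map σ.toEmbedding]
  congr 1
  ext j
  simp [Finset.mem_map_equiv]

/-- The parent has position at most `n - k`, so at least `k` indices are not before it, and the pair
of parent and child extends to a `k`-subset of these. -/
theorem exists_kSubset_parent {i : Fin n} (h : parent k σ i ≠ i) :
    ∃ S : KSubset n k, i ∈ S.1 ∧ parent k σ i ∈ S.1 ∧ ∀ j ∈ S.1, σ (parent k σ i) ≤ σ j := by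
  obtain ⟨hk, hkn⟩ := two_le_of_parent_ne h
  have h1 := coe_parent (σ := σ) hk hkn i
  obtain ⟨S, hS, hST, hcard⟩ := Finset.exists_subsuperset_card_eq (n := k)
    (s := {i, parent k σ i}) (t := Finset.univ.filter fun j => σ (parent k σ i) ≤ σ j)
    (by simp [Finset.insert_subset_iff, (parent_lt h).le])
    (by rw [Finset.card_pair h.symm]; exact hk)
    (by rw [card_filter_le]; omega)
  exact ⟨⟨S, hcard⟩, hS (by simp), hS (by simp), fun j hj => (Finset.mem_filter.mp (hST hj)).2⟩

variable (k σ) in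
/-- The branch of an index in the tree defined by `parent`. -/
def treeBranch : Fin n → (Fin n →₀ ℕ) := branch (parent k σ) σ fun _ => parent_lt

theorem treeBranch_of_eq {i : Fin n} (h : parent k σ i = i) :
    treeBranch k σ i = Finsupp.single i 1 := by
  rw [treeBranch, branch, dif_pos h, add_zero]

theorem treeBranch_of_ne {i : Fin n} (h : parent k σ i ≠ i) :
    treeBranch k σ i = Finsupp.single i 1 + treeBranch k σ (parent k σ i) := by
  rw [treeBranch, branch, dif_neg h]

/-- Positions up to `n - k` form a path, so the walk from `j` towards the root cannot skip `i`. -/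
theorem treeBranch_mono (hk : 2 ≤ k) (hkn : k ≤ n) {i : Fin n} (hi : (σ i : ℕ) ≤ n - k) (j : Fin n)
    (hij : σ i ≤ σ j) : treeBranch k σ i ≤ treeBranch k σ j := by
  induction hr : σ j using WellFoundedLT.induction generalizing j with
  | ind r ih =>
    subst hr
    rcases eq_or_ne i j with rfl | hne
    · rfl
    · have h1 := coe_parent (σ := σ) hk hkn j
      have h2 : (σ i : ℕ) ≠ σ j := fun e => hne (σ.injective (Fin.ext e))
      rw [Fin.le_def] at hij
      have h3 : parent k σ j ≠ j := by
        intro e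
        rw [e] at h1
        omega
      rw [treeBranch_of_ne h3]
      refine (ih _ (parent_lt h3) _ ?_ rfl).trans le_add_self
      rw [Fin.le_def]
      omega

/-- All `k` members of `S` are at or after its minimum, whose position is therefore at most `n - k`;
this makes it an ancestor of every member. -/
theorem treeBranch_le {c : Choice n k} (hc : IsMinChoice σ c) (S : KSubset n k) {j : Fin n}
    (hj : j ∈ S.1) : treeBranch k σ (c S) ≤ treeBranch k σ j := by
  rcases eq_or_ne (c S : Fin n) j with h | hne
  · rw [h]
  · have h1 : 1 < k := S.2 ▸ Finset.one_lt_card.mpr ⟨_, (c S).2, _, hj, hne⟩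
    have h2 : k ≤ n - σ (c S) := by
      rw [← card_filter_le]
      refine S.2.symm.trans_le ?_
      exact Finset.card_le_card fun l hl => Finset.mem_filter.mpr ⟨Finset.mem_univ _, hc S l hl⟩
    exact treeBranch_mono h1 (by omega) (by omega) j (hc S j hj)

end Branch

/-! ### Which charts cover the blowup -/

section Cover

variable {R : Type u} [CommRing R] {I : Ideal R}

theorem reesMonomial_mem_of_generators {ι : Type*} {g : ι → R}
    (hI : I = Ideal.span (Set.range g)) (hg : ∀ i, g i ∈ I) {P : Ideal (reesAlgebra I)}
    (hP : ∀ i, reesT I (g i) (hg i) ∈ P) (d : ℕ) (r : R) (hr : r ∈ I ^ (d + 1)) :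
    reesMonomial I (d + 1) r hr ∈ P := by
  have h1 (r : R) (hr : r ∈ I ^ 1) : reesMonomial I 1 r hr ∈ P := by
    have hr' : r ∈ Ideal.span (Set.range g) := by rwa [pow_one, hI] at hr
    induction hr' using Submodule.span_induction with
    | mem r hr' =>
      obtain ⟨i, rfl⟩ := hr'
      exact hP i
    | zero =>
      rw [reesMonomial_zero]
      exact P.zero_mem
    | add a b ha hb iha ihb =>
      replace ha : a ∈ I ^ 1 := by rw [pow_one, hI]; exact ha
      replace hb : b ∈ I ^ 1 := by rw [pow_one, hI]; exact hb
      rw [reesMonomial_add I ha hb]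
      exact P.add_mem (iha ha) (ihb hb)
    | smul a b hb ihb =>
      replace hb : b ∈ I ^ 1 := by rw [pow_one, hI]; exact hb
      have h := P.mul_mem_left (algebraMap R _ a) (ihb hb)
      rwa [← reesMonomial_const_mul] at h
  have hr' : r ∈ I ^ d * I ^ 1 := by rwa [← pow_add]
  induction hr' using Submodule.mul_induction_on' with
  | mem_mul_mem a ha b hb =>
    rw [← reesMonomial_mul I ha hb hr]
    exact P.mul_mem_left _ (h1 b hb)
  | add a ha b hb iha ihb =>
    rw [← pow_add] at ha hb
    rw [reesMonomial_add I ha hb]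
    exact P.add_mem (iha ha) (ihb hb)

theorem exists_reesMonomial_notMem (x : Proj (reesGrading I)) :
    ∃ d r, ∃ hr : r ∈ I ^ (d + 1), reesMonomial I (d + 1) r hr ∉ x.asHomogeneousIdeal := by
  by_contra! hx
  refine x.not_irrelevant_le ((HomogeneousIdeal.irrelevant_le _).mpr fun d hd f hf => ?_)
  obtain ⟨r, hr, rfl⟩ := exists_eq_reesMonomial I hf
  obtain ⟨d, rfl⟩ := Nat.exists_eq_add_one.mpr hd
  exact hx d r hr

/-- Generators of the ideal define charts that cover the blowup. -/
theorem exists_reesT_notMem {ι : Type*} (g : ι → R) (hI : I = Ideal.span (Set.range g))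
    (hg : ∀ i, g i ∈ I) (x : Proj (reesGrading I)) :
    ∃ i, reesT I (g i) (hg i) ∉ x.asHomogeneousIdeal := by
  by_contra! hx
  obtain ⟨d, r, hr, h⟩ := exists_reesMonomial_notMem x
  exact h (reesMonomial_mem_of_generators hI hg hx d r hr)

/-- A power of `s` in degree `m + 1` is a multiple of `t` in degree `1`, and the ideal of a point is
prime. Thus the chart of `s` lies in the chart of `t`. -/
theorem reesT_mem_of_mul_eq_pow {s t u : R} {m : ℕ} (hs : s ∈ I) (ht : t ∈ I) (hu : u ∈ I ^ m)
    (h : u * t = s ^ (m + 1)) (x : Proj (reesGrading I))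
    (hx : reesT I t ht ∈ x.asHomogeneousIdeal) : reesT I s hs ∈ x.asHomogeneousIdeal := by
  have h1 : reesMonomial I m u hu * reesT I t ht = reesT I s hs ^ (m + 1) := by
    have hs' : s ^ (m + 1) ∈ I ^ (1 * (m + 1)) := by
      rw [one_mul]
      exact Ideal.pow_mem_pow hs _
    have hut : u * t ∈ I ^ (m + 1) := h ▸ Ideal.pow_mem_pow hs _
    rw [reesT, reesT, reesMonomial_mul I _ _ hut, reesMonomial_pow I _ _ hs']
    exact reesMonomial_congr I _ _ (one_mul _).symm h
  refine x.isPrime.mem_of_pow_mem (m + 1) ?_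
  rw [← h1]
  exact x.asHomogeneousIdeal.toIdeal.mul_mem_left _ hx

end Cover

/-! ### Tameness: the vertex charts are affine spaces -/

section Permutohedral

variable (K : Type u) [Field K] {n k : ℕ}

open MvPolynomial

/-- The monomial `∏ x_{c(S)}`. -/
def choiceMonomial (c : Choice n k) : MvPolynomial (Fin n) K := monomial (choiceVector c) 1

theorem choiceMonomial_eq_prod (c : Choice n k) : choiceMonomial K c = ∏ S, X (c S : Fin n) := by
  rw [choiceMonomial, choiceVector, monomial_sum_one]
  rfl

variable (n k) in
theorem permutohedralIdeal_eq_span :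
    permutohedralIdeal K n k = Ideal.span (Set.range (choiceMonomial K (n := n) (k := k))) := by
  rw [permutohedralIdeal, Finset.prod_subtype (p := fun S => S.card = k) _ (by simp),
    Ideal.prod_span]
  congr 1
  ext f
  rw [Set.mem_fintype_prod]
  constructor
  · rintro ⟨g, hg, rfl⟩
    choose i hi hig using hg
    refine ⟨fun S => ⟨i S, hi S⟩, ?_⟩
    rw [choiceMonomial_eq_prod]
    exact Finset.prod_congr rfl fun S _ => hig S
  · rintro ⟨c, rfl⟩
    exact ⟨fun S => X (c S : Fin n), fun S => ⟨_, (c S).2, rfl⟩, (choiceMonomial_eq_prod K c).symm⟩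

theorem choiceMonomial_mem (c : Choice n k) : choiceMonomial K c ∈ permutohedralIdeal K n k := by
  rw [permutohedralIdeal_eq_span]
  exact Ideal.subset_span ⟨c, rfl⟩

theorem monomial_choiceSum_mem (m : Multiset (Choice n k)) :
    monomial (choiceSum m) (1 : K) ∈ permutohedralIdeal K n k ^ Multiset.card m := by
  induction m using Multiset.induction_on with
  | empty => simp
  | cons c m ih =>
    rw [← Multiset.singleton_add, map_add, choiceSum_singleton, Multiset.card_add,
      Multiset.card_singleton, pow_add, pow_one, ← mul_one (1 : K), ← monomial_mul]
    exact Ideal.mul_mem_mul (choiceMonomial_mem K c) ih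

theorem choiceMonomial_ne_zero (c : Choice n k) : choiceMonomial K c ≠ 0 := by
  simp [choiceMonomial]

theorem choiceMonomial_update (c : Choice n k) (S : KSubset n k) (j : {i : Fin n // i ∈ S.1}) :
    choiceMonomial K (Function.update c S j) * X (c S : Fin n) =
      choiceMonomial K c * X (j : Fin n) := by
  simp only [choiceMonomial, X, monomial_mul, choiceVector_update]

variable {σ : Equiv.Perm (Fin n)}

variable (k σ) in
/-- The substitution `x_i ↦ ∏ y_l`, where `l` runs over the branch of `i`. -/
def treeSubst : MvPolynomial (Fin n) K →+* MvPolynomial (Fin n) K :=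
  eval₂Hom C fun i => monomial (treeBranch k σ i) 1

theorem treeSubst_X (i : Fin n) : treeSubst K k σ (X i) = monomial (treeBranch k σ i) 1 :=
  eval₂Hom_X' ..

theorem treeSubst_X_of_eq {i : Fin n} (h : parent k σ i = i) : treeSubst K k σ (X i) = X i := by
  rw [treeSubst_X, treeBranch_of_eq h]
  rfl

theorem treeSubst_X_of_ne {i : Fin n} (h : parent k σ i ≠ i) :
    treeSubst K k σ (X i) = X i * treeSubst K k σ (X (parent k σ i)) := by
  rw [treeSubst_X, treeSubst_X, treeBranch_of_ne h, X, monomial_mul, one_mul]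

/-- Divisibility holds factor by factor: for each `S` the branch of the minimum is contained in the
branch of any other member. -/
theorem map_treeSubst_le {c : Choice n k} (hc : IsMinChoice σ c) :
    (permutohedralIdeal K n k).map (treeSubst K k σ) ≤
      Ideal.span {treeSubst K k σ (choiceMonomial K c)} := by
  rw [permutohedralIdeal_eq_span, Ideal.map_span, Ideal.span_le]
  rintro _ ⟨_, ⟨c', rfl⟩, rfl⟩
  rw [SetLike.mem_coe, Ideal.mem_span_singleton, choiceMonomial_eq_prod, choiceMonomial_eq_prod,
    map_prod, map_prod]
  refine Finset.prod_dvd_prod_of_dvd _ _ fun S _ => ?_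
  rw [treeSubst_X, treeSubst_X, monomial_dvd_monomial]
  exact ⟨Or.inr (treeBranch_le hc S (c' S).2), one_dvd _⟩

/-- The variable `y_i` is the quotient of the images of `x_i` and `x_{parent i}`, or the image of
`x_i` at a root. -/
theorem treeSubst_birational (q : MvPolynomial (Fin n) K) :
    ∃ r r', treeSubst K k σ r ≠ 0 ∧ q * treeSubst K k σ r = treeSubst K k σ r' := by
  induction q using MvPolynomial.induction_on with
  | C a => exact ⟨1, C a, by simp, by rw [map_one, mul_one]; exact (eval₂Hom_C ..).symm⟩
  | add p q hp hq =>
    obtain ⟨r, r', hr, h⟩ := hp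
    obtain ⟨s, s', hs, h'⟩ := hq
    refine ⟨r * s, r' * s + r * s', by rw [map_mul]; exact mul_ne_zero hr hs, ?_⟩
    rw [map_mul, map_add, map_mul, map_mul, ← h, ← h']
    ring
  | mul_X p i hp =>
    obtain ⟨r, r', hr, h⟩ := hp
    by_cases hi : parent k σ i = i
    · refine ⟨r, r' * X i, hr, ?_⟩
      rw [map_mul, ← h, treeSubst_X_of_eq K hi]
      ring
    · refine ⟨r * X (parent k σ i), r' * X i, ?_, ?_⟩
      · rw [map_mul, treeSubst_X]
        exact mul_ne_zero hr (by simp)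
      · rw [map_mul, map_mul, ← h, treeSubst_X_of_ne K hi]
        ring

theorem exists_kSubset_choice_eq_parent {c : Choice n k} (hc : IsMinChoice σ c) {i : Fin n}
    (h : parent k σ i ≠ i) : ∃ S : KSubset n k, i ∈ S.1 ∧ (c S : Fin n) = parent k σ i := by
  obtain ⟨S, hi, hp, hmin⟩ := exists_kSubset_parent h
  exact ⟨S, hi, σ.injective (le_antisymm (hc S _ hp) (hmin _ (c S).2))⟩

theorem smooth_C : (C : K →+* MvPolynomial (Fin n) K).Smooth := by
  rw [← algebraMap_eq, RingHom.smooth_algebraMap]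
  exact {}

theorem smooth_of_affineBlowup {B : Type u} [CommRing B] [IsDomain B] {c : Choice n k}
    (hc : IsMinChoice σ c) (j : MvPolynomial (Fin n) K →+* B) (hinj : Function.Injective j)
    (hB : ∀ b, ∃ d, ∃ r ∈ permutohedralIdeal K n k ^ d, b * j (choiceMonomial K c) ^ d = j r)
    (hB' : ∀ r ∈ permutohedralIdeal K n k, ∃ b, b * j (choiceMonomial K c) = j r) :
    (j.comp C).Smooth := by
  have hs0 := choiceMonomial_ne_zero K c
  have hjs : j (choiceMonomial K c) ≠ 0 := fun h => hs0 (hinj (by rw [h, map_zero]))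
  have hY (i : Fin n) : ∃ Y, (parent k σ i = i → Y = j (X i)) ∧
      (parent k σ i ≠ i → Y * j (X (parent k σ i)) = j (X i)) := by
    by_cases hi : parent k σ i = i
    · exact ⟨j (X i), fun _ => rfl, fun h => absurd hi h⟩
    · obtain ⟨S, hiS, hcS⟩ := exists_kSubset_choice_eq_parent hc hi
      -- Replacing the chosen element `parent k σ i` of `S` by `i` multiplies the monomial by `x_i /
      -- x_{parent i}`, which is therefore a function on the chart.
      obtain ⟨Y, hY⟩ := hB' _ (choiceMonomial_mem K (Function.update c S ⟨i, hiS⟩))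
      refine ⟨Y, fun h => absurd h hi, fun _ => ?_⟩
      apply mul_right_cancel₀ hjs
      rw [mul_right_comm, hY, ← map_mul, ← map_mul, ← hcS, choiceMonomial_update, mul_comm]
  choose Y hY0 hY1 using hY
  let φ : MvPolynomial (Fin n) K →+* B :=
    eval₂Hom (j.comp C) Y
  have hφX (i : Fin n) : φ (X i) = Y i := eval₂Hom_X' ..
  have hφψX (i : Fin n) : φ (treeSubst K k σ (X i)) = j (X i) := by
    induction hr : σ i using WellFoundedLT.induction generalizing i with
    | ind r ih =>
      subst hr
      by_cases hi : parent k σ i = i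
      · rw [treeSubst_X_of_eq K hi, hφX, hY0 i hi]
      · rw [treeSubst_X_of_ne K hi, map_mul, ih _ (parent_lt hi) _ rfl, hφX, hY1 i hi]
  have hφψ : φ.comp (treeSubst K k σ) = j := by
    refine MvPolynomial.ringHom_ext (fun a => ?_) hφψX
    rw [RingHom.comp_apply, treeSubst, eval₂Hom_C]
    exact eval₂Hom_C ..
  have hφC : j.comp C = φ.comp C := by
    ext a
    exact (eval₂Hom_C ..).symm
  have hbij : Function.Bijective φ :=
    bijective_of_affineBlowup hs0 j hinj hB (treeSubst K k σ) φ
      (RingHom.congr_fun hφψ) (map_treeSubst_le K hc) (treeSubst_birational K)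
  rw [hφC]
  exact (smooth_C K).comp (RingHom.Smooth.of_bijective hbij)

theorem smooth_chart {c : Choice n k} (hc : IsMinChoice σ c) :
    ((toBlowupChart _ _ (choiceMonomial_mem K c)).comp C).Smooth := by
  have hs0 := choiceMonomial_ne_zero K c
  have hdom := blowupChart_isDomain (choiceMonomial_mem K c) hs0
  exact smooth_of_affineBlowup K hc
    (toBlowupChart (permutohedralIdeal K n k) _ (choiceMonomial_mem K c))
    (toBlowupChart_injective (choiceMonomial_mem K c) hs0)
    (blowupChart_exists_rep (choiceMonomial_mem K c))
    fun r hr => blowupChart_exists_mul_eq (choiceMonomial_mem K c) hr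

variable (n k) in
theorem isTame_permutohedralIdeal : IsTame (permutohedralIdeal K n k) := by
  refine smooth_blowup_of_charts C
    (fun c : {c : Choice n k // ∃ σ, IsMinChoice σ c} => choiceMonomial K c.1)
    (fun c => choiceMonomial_mem K c.1) (fun x => ?_) fun c => ?_
  · obtain ⟨c, hc⟩ := exists_reesT_notMem _ (permutohedralIdeal_eq_span K n k)
      (choiceMonomial_mem K) x
    -- The chart of `c` is contained in that of the vertex `f`.
    obtain ⟨σ, f, m, hf, hm⟩ := exists_isMinChoice_add_eq c
    refine ⟨⟨f, σ, hf⟩, fun h => hc ?_⟩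
    refine reesT_mem_of_mul_eq_pow _ _ (monomial_choiceSum_mem K m) ?_ x h
    rw [choiceMonomial, choiceMonomial, monomial_mul, hm, monomial_pow, one_mul, one_pow]
  · obtain ⟨σ, hσ⟩ := c.2
    exact smooth_chart K hσ

end Permutohedral

/-! ### Support and cloud of the ideal -/

section Support

variable (K : Type u) [Field K] {n k : ℕ}

theorem mem_idealSupport_iff {a : Fin n →₀ ℕ} :
    a ∈ idealSupport (permutohedralIdeal K n k) ↔ ∃ c : Choice n k, choiceVector c ≤ a := by
  classical
  have h : Set.range (choiceMonomial K (n := n) (k := k)) =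
      (fun b => MvPolynomial.monomial b (1 : K)) '' Set.range (choiceVector (n := n) (k := k)) := by
    rw [← Set.range_comp]
    rfl
  change MvPolynomial.monomial a (1 : K) ∈ permutohedralIdeal K n k ↔ _
  rw [permutohedralIdeal_eq_span, h, MvPolynomial.mem_ideal_span_monomial_image,
    MvPolynomial.support_monomial, if_neg one_ne_zero]
  simp

theorem choiceVector_mem_idealSupport (c : Choice n k) :
    choiceVector c ∈ idealSupport (permutohedralIdeal K n k) :=
  (mem_idealSupport_iff K).mpr ⟨c, le_rfl⟩

/-- All generators have the same degree, so none properly divides another. -/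
theorem mem_cloud_iff {a : Fin n →₀ ℕ} :
    a ∈ cloud (permutohedralIdeal K n k) ↔ ∃ c : Choice n k, choiceVector c = a := by
  constructor
  · intro h
    obtain ⟨c, hc⟩ := (mem_idealSupport_iff K).mp h.prop
    exact ⟨c, h.eq_of_le (choiceVector_mem_idealSupport K c) hc⟩
  · rintro ⟨c, rfl⟩
    refine ⟨choiceVector_mem_idealSupport K c, fun b hb hbc => ?_⟩
    obtain ⟨c', hc'⟩ := (mem_idealSupport_iff K).mp hb
    obtain ⟨d, hd⟩ := exists_add_of_le (hc'.trans hbc)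
    have h := congrArg Finsupp.degree hd
    rw [map_add, degree_choiceVector, degree_choiceVector, Nat.left_eq_add,
      Finsupp.degree_eq_zero_iff] at h
    rw [hd, h, add_zero]
    exact hc'

end Support

/-! ### Extreme points of convex hulls -/

section Convexity

variable {E : Type*} [AddCommGroup E] [Module ℝ E]

/-- A point of a set is extreme in the convex hull if it is the only minimum of a linear form. -/
theorem mem_extremePoints_convexHull_of_forall_lt {s : Set E} {x : E} (hx : x ∈ s) (l : E →ₗ[ℝ] ℝ)
    (hl : ∀ y ∈ s, y = x ∨ l x < l y) : x ∈ Set.extremePoints ℝ (convexHull ℝ s) := by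
  -- The set of points that equal `x` or have a larger value of `l` is convex.
  have key : ∀ y ∈ convexHull ℝ s, y = x ∨ l x < l y := by
    refine fun y hy => convexHull_min (t := {y | y = x ∨ l x < l y}) hl ?_ hy
    intro y hy z hz a b ha hb hab
    rcases ha.eq_or_lt with rfl | ha
    · rw [zero_add] at hab
      subst hab
      simpa using hz
    rcases hb.eq_or_lt with rfl | hb
    · rw [add_zero] at hab
      subst hab
      simpa using hy
    have hx' : l x = a * l x + b * l x := by rw [← add_mul, hab, one_mul]
    simp only [Set.mem_ofPred_eq, map_add, map_smul, smul_eq_mul]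
    rcases hy with rfl | hy <;> rcases hz with rfl | hz
    · left
      rw [← add_smul, hab, one_smul]
    · right
      have := mul_lt_mul_of_pos_left hz hb
      linarith
    · right
      have := mul_lt_mul_of_pos_left hy ha
      linarith
    · right
      have := mul_lt_mul_of_pos_left hz hb
      have := mul_lt_mul_of_pos_left hy ha
      linarith
  refine ⟨subset_convexHull ℝ s hx, fun y hy z hz hxyz => ?_⟩
  obtain ⟨a, b, ha, hb, hab, rfl⟩ := hxyz
  rcases key y hy with h | hy'
  · exact h
  · exfalso
    set x := a • y + b • z with hxdef
    have h1 : l x = a * l y + b * l z := by simp [hxdef]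
    have h2 : l x = a * l x + b * l x := by rw [← add_mul, hab, one_mul]
    have h3 := mul_lt_mul_of_pos_left hy' ha
    have h4 : l x ≤ l z := by
      rcases key z hz with h | h
      · rw [h]
      · exact h.le
    have h5 := mul_le_mul_of_nonneg_left h4 hb.le
    linarith

/-- The point `x` is the convex combination of `y` and `z` with weights `1/(p+1)` and `p/(p+1)`. The
second weight vanishes for `p = 0`, where the equation itself is the claim. -/
theorem eq_of_mem_extremePoints {N : Set E} {x y z : E} (hx : x ∈ Set.extremePoints ℝ N)
    (hy : y ∈ N) (hz : z ∈ N) (p : ℕ) (h : (p : ℝ) • z + y = (p + 1 : ℝ) • x) : y = x := by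
  have hp : (0 : ℝ) < p + 1 := by positivity
  have hx' : x = (1 / (p + 1 : ℝ)) • y + (p / (p + 1 : ℝ)) • z := by
    rw [← inv_smul_smul₀ hp.ne' x, ← h, smul_add, smul_smul, add_comm, one_div, div_eq_inv_mul]
  rcases Nat.eq_zero_or_pos p with rfl | hp'
  · simpa using h
  · have hp'' : (0 : ℝ) < p := by exact_mod_cast hp'
    refine hx.2 hy hz ⟨1 / (p + 1 : ℝ), p / (p + 1 : ℝ), by positivity, by positivity, ?_, hx'.symm⟩
    field_simp
    ring

end Convexity

/-! ### Vertices of the Newton polyhedron -/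

section Vertices

variable (K : Type u) [Field K] {n k : ℕ}

theorem toRealPoint_add (a b : Fin n →₀ ℕ) :
    toRealPoint (a + b) = toRealPoint a + toRealPoint b := by
  ext i
  simp [toRealPoint]

theorem toRealPoint_smul (p : ℕ) (a : Fin n →₀ ℕ) :
    toRealPoint (p • a) = (p : ℝ) • toRealPoint a := by
  ext i
  simp [toRealPoint]

theorem toRealPoint_injective : Function.Injective (toRealPoint (n := n)) := by
  intro a b h
  ext i
  exact Nat.cast_injective (R := ℝ) (congrFun h i)

theorem toRealPoint_mem_newtonPolyhedron {a : Fin n →₀ ℕ}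
    (ha : a ∈ idealSupport (permutohedralIdeal K n k)) :
    toRealPoint a ∈ newtonPolyhedron (permutohedralIdeal K n k) :=
  subset_convexHull ℝ _ ⟨a, ha, rfl⟩

/-- The point `z` is the average of the members of `m`; for empty `m` any point will do, and `c`
supplies one. -/
theorem exists_smul_eq_choiceSum (c : Choice n k) (m : Multiset (Choice n k)) :
    ∃ z ∈ newtonPolyhedron (permutohedralIdeal K n k),
      (Multiset.card m : ℝ) • z = toRealPoint (choiceSum m) := by
  induction m using Multiset.induction_on with
  | empty =>
    refine ⟨_, toRealPoint_mem_newtonPolyhedron K (choiceVector_mem_idealSupport K c), ?_⟩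
    ext i
    simp [toRealPoint]
  | cons b m ih =>
    obtain ⟨z, hz, h⟩ := ih
    have hb := toRealPoint_mem_newtonPolyhedron K (choiceVector_mem_idealSupport K b)
    set p : ℝ := (Multiset.card m : ℝ)
    have hp : 0 < 1 + p := by positivity
    refine ⟨(1 / (1 + p)) • toRealPoint (choiceVector b) + (p / (1 + p)) • z,
      convex_convexHull ℝ _ hb hz (by positivity) (by positivity) (by field_simp), ?_⟩
    rw [← Multiset.singleton_add, map_add, choiceSum_singleton, toRealPoint_add, ← h,
      Multiset.card_add, Multiset.card_singleton, Nat.cast_add, Nat.cast_one, smul_add, smul_smul,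
      smul_smul, mul_one_div_cancel hp.ne', mul_div_cancel₀ _ hp.ne', one_smul]

/-- The linear form with coefficients `σ i + 1`. -/
def weight (σ : Equiv.Perm (Fin n)) : (Fin n →₀ ℕ) →+ ℕ :=
  Finsupp.liftAddHom fun i => AddMonoidHom.mulLeft ((σ i : ℕ) + 1)

theorem weight_single (σ : Equiv.Perm (Fin n)) (i : Fin n) :
    weight σ (Finsupp.single i 1) = σ i + 1 := by
  simp [weight]

theorem weight_eq_zero {σ : Equiv.Perm (Fin n)} {a : Fin n →₀ ℕ} (h : weight σ a = 0) : a = 0 := by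
  ext i
  by_contra hi
  have h1 : Finsupp.single i 1 ≤ a := by
    rw [Finsupp.single_le_iff]
    exact Nat.one_le_iff_ne_zero.mpr hi
  obtain ⟨d, rfl⟩ := exists_add_of_le h1
  rw [map_add, weight_single] at h
  omega

theorem weight_choiceVector (σ : Equiv.Perm (Fin n)) (c : Choice n k) :
    weight σ (choiceVector c) = ∑ S, ((σ (c S) : ℕ) + 1) := by
  simp only [choiceVector, map_sum, weight_single]

/-- A minimal choice minimizes each summand of the weight separately, with equality only for the
same element; a nonzero excess `d` adds weight because the coefficients are positive. -/
theorem eq_or_weight_lt {σ : Equiv.Perm (Fin n)} {c : Choice n k} (hc : IsMinChoice σ c)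
    {a : Fin n →₀ ℕ} (ha : a ∈ idealSupport (permutohedralIdeal K n k)) :
    a = choiceVector c ∨ weight σ (choiceVector c) < weight σ a := by
  obtain ⟨c', hc'⟩ := (mem_idealSupport_iff K).mp ha
  obtain ⟨d, rfl⟩ := exists_add_of_le hc'
  have hle (S : KSubset n k) (_ : S ∈ Finset.univ) : (σ (c S) : ℕ) + 1 ≤ (σ (c' S) : ℕ) + 1 :=
    Nat.succ_le_succ (hc S _ (c' S).2)
  rw [map_add, weight_choiceVector, weight_choiceVector]
  rcases Nat.eq_zero_or_pos (weight σ d) with hd | hd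
  · rcases (Finset.sum_le_sum hle).eq_or_lt with h | h
    · left
      have h' := (Finset.sum_eq_sum_iff_of_le hle).mp h
      have : c' = c := by
        funext S
        have := h' S (Finset.mem_univ S)
        exact Subtype.ext (σ.injective (Fin.ext (by omega)))
      rw [this, weight_eq_zero hd, add_zero]
    · right
      omega
  · right
    have := Finset.sum_le_sum hle
    omega

theorem exists_linearMap_weight (σ : Equiv.Perm (Fin n)) :
    ∃ l : (Fin n → ℝ) →ₗ[ℝ] ℝ, ∀ a, l (toRealPoint a) = weight σ a := by
  refine ⟨Fintype.linearCombination ℝ fun i => ((σ i : ℕ) : ℝ) + 1, fun a => ?_⟩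
  rw [Fintype.linearCombination_apply, weight, Finsupp.liftAddHom_apply,
    Finsupp.sum_fintype _ _ (by simp)]
  simp [toRealPoint, mul_comm]

variable (n k) in
theorem newtonVertices_permutohedralIdeal :
    newtonVertices (permutohedralIdeal K n k) =
      {v | ∃ (σ : Equiv.Perm (Fin n)) (c : Choice n k),
        IsMinChoice σ c ∧ v = toRealPoint (choiceVector c)} := by
  ext v
  constructor
  · intro hv
    obtain ⟨a, ha, rfl⟩ := extremePoints_convexHull_subset hv
    obtain ⟨c, hc⟩ := (mem_idealSupport_iff K).mp ha
    obtain ⟨d, rfl⟩ := exists_add_of_le hc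
    have hcN := toRealPoint_mem_newtonPolyhedron K (choiceVector_mem_idealSupport K c)
    have hac : toRealPoint (choiceVector c) = toRealPoint (choiceVector c + d) := by
      -- The point `v(c) + d` is the midpoint of `v(c)` and `v(c) + 2d`, so at a vertex `d`
      -- vanishes.
      have hd : choiceVector c + (d + d) ∈ idealSupport (permutohedralIdeal K n k) :=
        (mem_idealSupport_iff K).mpr ⟨c, le_self_add⟩
      refine eq_of_mem_extremePoints hv hcN (toRealPoint_mem_newtonPolyhedron K hd) 1 ?_
      ext i
      simp [toRealPoint]
      ring
    rw [← hac] at hv ⊢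
    obtain ⟨σ, f, m, hf, hm⟩ := exists_isMinChoice_add_eq c
    obtain ⟨z, hz, h⟩ := exists_smul_eq_choiceSum K c m
    refine ⟨σ, f, hf, (eq_of_mem_extremePoints hv
      (toRealPoint_mem_newtonPolyhedron K (choiceVector_mem_idealSupport K f)) hz
      (Multiset.card m) ?_).symm⟩
    rw [h, ← toRealPoint_add, hm, toRealPoint_smul, Nat.cast_add, Nat.cast_one]
  · rintro ⟨σ, c, hc, rfl⟩
    obtain ⟨l, hl⟩ := exists_linearMap_weight σ
    refine mem_extremePoints_convexHull_of_forall_lt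
      ⟨_, choiceVector_mem_idealSupport K c, rfl⟩ l ?_
    rintro _ ⟨a, ha, rfl⟩
    rw [hl, hl, Nat.cast_lt]
    exact (eq_or_weight_lt K hc ha).imp_left (congrArg _)

/-- The coordinate counts the `k`-subsets with minimum `i`; removing `i` leaves an arbitrary
`(k-1)`-subset of the `n - 1 - σ i` later indices. -/
theorem choiceVector_apply (hk : 1 ≤ k) {σ : Equiv.Perm (Fin n)} {c : Choice n k}
    (hc : IsMinChoice σ c) (i : Fin n) :
    choiceVector c i = (n - 1 - (σ i : ℕ)).choose (k - 1) := by
  have hU : (Finset.univ.filter fun j => σ i < σ j).card = n - 1 - σ i := by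
    rw [← Fin.card_Ioi, ← Finset.card_map σ.toEmbedding]
    congr 1
    ext j
    simp [Finset.mem_map_equiv]
  have h1 : choiceVector c i =
      (Finset.univ.filter fun S : KSubset n k => (c S : Fin n) = i).card := by
    rw [choiceVector, Finsupp.finsetSum_apply, Finset.card_filter]
    exact Finset.sum_congr rfl fun S _ => Finsupp.single_apply
  rw [h1, ← hU, ← Finset.card_powersetCard]
  refine Finset.card_bij (fun S _ => S.1.erase i) ?_ ?_ ?_
  · intro S hS
    have hS' : (c S : Fin n) = i := (Finset.mem_filter.mp hS).2
    have hi : i ∈ S.1 := hS' ▸ (c S).2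
    rw [Finset.mem_powersetCard, Finset.card_erase_of_mem hi, S.2]
    refine ⟨fun j hj => ?_, rfl⟩
    rw [Finset.mem_filter]
    refine ⟨Finset.mem_univ j, lt_of_le_of_ne ?_ fun e =>
      Finset.ne_of_mem_erase hj (σ.injective e).symm⟩
    exact hS' ▸ hc S j (Finset.mem_of_mem_erase hj)
  · intro S hS T hT h
    have hS' : i ∈ S.1 := (Finset.mem_filter.mp hS).2 ▸ (c S).2
    have hT' : i ∈ T.1 := (Finset.mem_filter.mp hT).2 ▸ (c T).2
    apply Subtype.ext
    rw [← Finset.insert_erase hS', ← Finset.insert_erase hT', h]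
  · intro T hT
    obtain ⟨hTU, hTc⟩ := Finset.mem_powersetCard.mp hT
    have hi : i ∉ T := fun h => lt_irrefl _ (Finset.mem_filter.mp (hTU h)).2
    have hcard : (insert i T).card = k := by
      rw [Finset.card_insert_of_notMem hi, hTc]
      omega
    refine ⟨⟨insert i T, hcard⟩, ?_, Finset.erase_insert hi⟩
    rw [Finset.mem_filter]
    refine ⟨Finset.mem_univ _, ?_⟩
    have h2 := hc ⟨insert i T, hcard⟩ i (Finset.mem_insert_self i T)
    rcases Finset.mem_insert.mp (c ⟨insert i T, hcard⟩).2 with h | h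
    · exact h
    · exact absurd (Finset.mem_filter.mp (hTU h)).2 h2.not_gt

theorem toRealPoint_choiceVector (hk : 1 ≤ k) {σ : Equiv.Perm (Fin n)} {c : Choice n k}
    (hc : IsMinChoice σ c) : toRealPoint (choiceVector c) = fun i => maxVector n k (σ i) := by
  ext i
  rw [toRealPoint, maxVector, choiceVector_apply hk hc]

end Vertices

/-! ### Ideal tangent cones at the vertices -/

section Cone

variable {n : ℕ}

/-- The nonnegative orthant of a basis of `ℤ ^ n` is a simplicial cone. -/
theorem isSimplicialCone_of_dual {C : AddSubmonoid (Fin n → ℤ)} (g : Fin n → Fin n → ℤ)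
    (Λ : (Fin n → ℤ) →ₗ[ℤ] (Fin n → ℤ)) (hΛ : ∀ i, Λ (g i) = Pi.single i 1)
    (hg : ∀ v, ∑ i, Λ v i • g i = v) (hC : ∀ v ∈ C, 0 ≤ Λ v) (hgC : ∀ i, g i ∈ C) :
    IsSimplicialCone C := by
  have hΛ0 {v : Fin n → ℤ} (h : Λ v = 0) : v = 0 := by
    rw [← hg v, h]
    simp
  have hinj : Function.Injective g := by
    intro i j h
    by_contra hij
    have h' := congrFun ((hΛ i).symm.trans ((congrArg Λ h).trans (hΛ j))) i
    simp [Pi.single_eq_of_ne hij] at h'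
  refine ⟨fun v hv hv' => hΛ0 (le_antisymm ?_ (hC v hv)), Finset.univ.image g, ⟨?_, ?_⟩, ?_⟩
  · have h := hC _ hv'
    rwa [map_neg, Left.nonneg_neg_iff] at h
  · apply le_antisymm
    · rw [AddSubmonoid.closure_le]
      intro v hv
      obtain ⟨i, rfl⟩ : ∃ i, g i = v := by simpa using hv
      exact hgC i
    · intro v hv
      rw [← hg v]
      refine sum_mem fun i _ => ?_
      obtain ⟨p, hp⟩ := Int.eq_ofNat_of_zero_le (hC v hv i)
      rw [hp, natCast_zsmul]
      exact nsmul_mem (AddSubmonoid.subset_closure (by simp)) p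
  · intro v hv hv'
    obtain ⟨i, rfl⟩ : ∃ i, g i = v := by simpa using hv
    -- The coordinate `i` vanishes on the span of the other generators, but is `1` on `g i`.
    have h : ∀ u ∈ AddSubmonoid.closure (((Finset.univ.image g : Finset (Fin n → ℤ)) :
        Set (Fin n → ℤ)) \ {g i}), Λ u i = 0 := by
      intro u hu
      induction hu using AddSubmonoid.closure_induction with
      | mem u hu =>
        obtain ⟨j, rfl⟩ : ∃ j, g j = u := by simpa using hu.1
        have hij : i ≠ j := fun h => hu.2 (h ▸ rfl)
        rw [hΛ, Pi.single_eq_of_ne hij]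
      | zero => simp
      | add u w _ _ hu hw => rw [map_add, Pi.add_apply, hu, hw, add_zero]
    have h1 := h _ hv'
    rw [hΛ, Pi.single_eq_same] at h1
    exact one_ne_zero h1
  · rw [Finset.card_image_of_injective _ hinj, Finset.card_univ, Fintype.card_fin]

variable (K : Type u) [Field K] {k : ℕ} {σ : Equiv.Perm (Fin n)}

variable (k σ) in
/-- The edge from the parent of an index to the index; for a root it starts at the origin. -/
def treeEdge (i : Fin n) : Fin n → ℤ :=
  Pi.single i 1 - if parent k σ i = i then 0 else Pi.single (parent k σ i) 1

variable (k σ) in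
/-- The coordinates with respect to the edges of the tree. -/
def treeCoord : (Fin n → ℤ) →ₗ[ℤ] (Fin n → ℤ) :=
  Fintype.linearCombination ℤ fun i => toLatticePoint (treeBranch k σ i)

theorem toLatticePoint_add (a b : Fin n →₀ ℕ) :
    toLatticePoint (a + b) = toLatticePoint a + toLatticePoint b := by
  ext i
  simp [toLatticePoint]

theorem toLatticePoint_single (i : Fin n) :
    toLatticePoint (Finsupp.single i 1) = Pi.single i 1 := by
  ext j
  simp [toLatticePoint, Finsupp.single_apply, Pi.single_apply, eq_comm]

theorem toLatticePoint_choiceVector (c : Choice n k) :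
    toLatticePoint (choiceVector c) = ∑ S, Pi.single (c S : Fin n) 1 := by
  simp_rw [← toLatticePoint_single]
  ext i
  simp [toLatticePoint, choiceVector, Finsupp.finsetSum_apply]

theorem toLatticePoint_mono {a b : Fin n →₀ ℕ} (h : a ≤ b) :
    toLatticePoint a ≤ toLatticePoint b :=
  fun i => Int.ofNat_le.mpr (h i)

theorem treeCoord_single (i : Fin n) :
    treeCoord k σ (Pi.single i 1) = toLatticePoint (treeBranch k σ i) := by
  rw [treeCoord, Fintype.linearCombination_apply_single, one_smul]

theorem treeCoord_treeEdge (i : Fin n) : treeCoord k σ (treeEdge k σ i) = Pi.single i 1 := by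
  rw [treeEdge, map_sub, treeCoord_single]
  by_cases h : parent k σ i = i
  · rw [if_pos h, treeBranch_of_eq h, map_zero, sub_zero, toLatticePoint_single]
  · rw [if_neg h, treeBranch_of_ne h, treeCoord_single, toLatticePoint_add, add_sub_cancel_right,
      toLatticePoint_single]

theorem sum_treeBranch_smul_treeEdge (i : Fin n) :
    ∑ l, toLatticePoint (treeBranch k σ i) l • treeEdge k σ l = Pi.single i 1 := by
  have hs (i : Fin n) : ∑ l, (Pi.single i 1 : Fin n → ℤ) l • treeEdge k σ l = treeEdge k σ i := by
    rw [Finset.sum_eq_single i (fun l _ hl => by rw [Pi.single_eq_of_ne hl, zero_smul]) (by simp),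
      Pi.single_eq_same, one_smul]
  induction hr : σ i using WellFoundedLT.induction generalizing i with
  | ind r ih =>
    subst hr
    by_cases h : parent k σ i = i
    · rw [treeBranch_of_eq h, toLatticePoint_single, hs, treeEdge, if_pos h, sub_zero]
    · simp only [treeBranch_of_ne h, toLatticePoint_add, toLatticePoint_single, Pi.add_apply,
        add_smul, Finset.sum_add_distrib, hs, ih _ (parent_lt h) _ rfl]
      rw [treeEdge, if_neg h, sub_add_cancel]

theorem sum_treeCoord_smul_treeEdge (v : Fin n → ℤ) :
    ∑ l, treeCoord k σ v l • treeEdge k σ l = v := by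
  have h : (Fintype.linearCombination ℤ (treeEdge k σ)).comp (treeCoord k σ) = LinearMap.id := by
    refine (Pi.basisFun ℤ (Fin n)).ext fun i => ?_
    rw [LinearMap.comp_apply, Pi.basisFun_apply, treeCoord_single, LinearMap.id_apply,
      Fintype.linearCombination_apply]
    exact sum_treeBranch_smul_treeEdge i
  exact LinearMap.congr_fun h v

theorem treeCoord_choiceVector (c : Choice n k) :
    treeCoord k σ (toLatticePoint (choiceVector c)) =
      ∑ S, toLatticePoint (treeBranch k σ (c S)) := by
  simp only [toLatticePoint_choiceVector, map_sum, treeCoord_single]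

/-- Generators of the cone have nonnegative tree coordinates by `treeBranch_le`. Conversely, each
edge is a generator: a basis vector at a root, and otherwise the difference made by changing the
choice in a single subset. -/
theorem isSimplicialCone_idealTangentCone {c : Choice n k} (hc : IsMinChoice σ c) :
    IsSimplicialCone (idealTangentCone (permutohedralIdeal K n k) (choiceVector c)) := by
  refine isSimplicialCone_of_dual (treeEdge k σ) (treeCoord k σ) treeCoord_treeEdge
    sum_treeCoord_smul_treeEdge (fun v hv => ?_) fun i => ?_
  · rw [idealTangentCone, ← AddSubmonoid.closure_union] at hv
    induction hv using AddSubmonoid.closure_induction with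
    | mem v hv =>
      rcases hv with ⟨a, ha, -, rfl⟩ | ⟨i, rfl⟩
      · obtain ⟨c', rfl⟩ := (mem_cloud_iff K).mp ha
        rw [map_sub, sub_nonneg, treeCoord_choiceVector, treeCoord_choiceVector]
        exact Finset.sum_le_sum fun S _ => toLatticePoint_mono (treeBranch_le hc S (c' S).2)
      · dsimp only
        rw [treeCoord_single]
        exact fun l => Int.natCast_nonneg _
    | zero => rw [map_zero]
    | add u v _ _ hu hv =>
      rw [map_add]
      exact add_nonneg hu hv
  · rw [treeEdge]
    by_cases h : parent k σ i = i
    · rw [if_pos h, sub_zero]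
      exact AddSubmonoid.mem_sup_right (AddSubmonoid.subset_closure ⟨i, rfl⟩)
    · obtain ⟨S, hiS, hcS⟩ := exists_kSubset_choice_eq_parent hc h
      have hu := choiceVector_update c S ⟨i, hiS⟩
      rw [if_neg h, ← hcS]
      refine AddSubmonoid.mem_sup_left (AddSubmonoid.subset_closure
        ⟨_, (mem_cloud_iff K).mpr ⟨Function.update c S ⟨i, hiS⟩, rfl⟩, fun e => ?_, ?_⟩)
      · rw [e] at hu
        have := Finsupp.single_left_injective one_ne_zero (add_left_cancel hu)
        exact h (hcS.symm.trans this)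
      · have hu' := congrArg toLatticePoint hu
        rw [toLatticePoint_add, toLatticePoint_add, toLatticePoint_single,
          toLatticePoint_single] at hu'
        rw [sub_eq_sub_iff_add_eq_add, add_comm, ← hu']

end Cone
end

theorem mainTheorem3 (K : Type u) [Field K] (n k : ℕ) :
    IsTame (permutohedralIdeal K n k) ∧
      (1 ≤ k → newtonVertices (permutohedralIdeal K n k) =
        {v : Fin n → ℝ | ∃ σ : Equiv.Perm (Fin n), v = fun i => maxVector n k (σ i)}) ∧
      ∀ a : Fin n →₀ ℕ, toRealPoint a ∈ newtonVertices (permutohedralIdeal K n k) →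
        IsSimplicialCone (idealTangentCone (permutohedralIdeal K n k) a) := by
  refine ⟨isTame_permutohedralIdeal K n k, fun hk => ?_, fun a ha => ?_⟩
  · rw [newtonVertices_permutohedralIdeal]
    ext v
    constructor
    · rintro ⟨σ, c, hc, rfl⟩
      exact ⟨σ, toRealPoint_choiceVector hk hc⟩
    · rintro ⟨σ, rfl⟩
      -- Here `1 ≤ k` is needed: the empty set has no minimum.
      obtain ⟨c, hc⟩ := exists_isMinChoice (k := k)
        (fun S => Finset.card_pos.mp (hk.trans_eq S.2.symm)) σ
      exact ⟨σ, c, hc, (toRealPoint_choiceVector hk hc).symm⟩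
  · rw [newtonVertices_permutohedralIdeal] at ha
    obtain ⟨σ, c, hc, hac⟩ := ha
    rw [toRealPoint_injective hac]
    exact isSimplicialCone_idealTangentCone K hc
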